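/- Let $n\ge 1$ and $c(x,\bar x)=-\langle x,\bar x\rangle$ on $\mathbf{R}^n\times\mathbf{R}^n$. Let $\mu,\nu$ be probability measures on $\mathbf{R}^n$, absolutely continuous with respect to Lebesgue measure, with bounded supports $\operatorname{spt}\mu$, $\operatorname{spt}\nu$. Suppose $\operatorname{spt}\nu=\overline\Omega_1\cup\overline\Omega_2$ with $\overline\Omega_1,\overline\Omega_2$ nonempty and strongly separated by a hyperplane $\Pi=\{x\mid\langle x,v\rangle=a\}$, where $|v|=1$ and $v$ is oriented towards $\overline\Omega_1$: for some $d>0$, $\langle \bar x_2,v\rangle<a-d<a+d<\langle \bar x_1,v\rangle$ for all $\bar x_1\in\overline\Omega_1$, $\bar x_2\in\overline\Omega_2$. Call $u:\mathbf{R}^n\to\mathbf{R}$ an optimal potential transporting $\mu$ to $\nu$ if $u$ is convex (hence differentiable almost everywhere), $\nabla u$ pushes $\mu$ forward to $\nu$ and minimizes $\int c(x,S(x))\,\mu(dx)$ among all Borel maps $S$ with $S_\#\mu=\nu$, and $\nabla u(x)\in\operatorname{spt}\nu$ at every point $x$ where $u$ is differentiable. Write $\partial u(x)=\{\bar x\mid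 \langle y-x,\bar x\rangle+u(x)\le u(y)\ \forall y\in\mathbf{R}^n\}$. Then an optimal potential exists, and every optimal potential $u$ has the following properties. (1) There are convex functions $u_1,u_2:\mathbf{R}^n\to\mathbf{R}$ with $u=\max\{u_1,u_2\}$ such that, for $i=1,2$, $\nabla u_i(x)\in\overline\Omega_i$ at every point $x$ where $u_i$ is differentiable, and $$\Sigma:=\{x\mid \partial u(x)\cap\overline\Omega_i\ne\emptyset,\ i=1,2\}=\{u_1=u_2\},$$ $$C_1:=\{x\mid\partial u(x)\cap\overline\Omega_2=\emptyset\}=\{u_1>u_2\},\qquad C_2:=\{x\mid\partial u(x)\cap\overline\Omega_1=\emptyset\}=\{u_1<u_2\}.$$ (2) The sets $\Sigma$, $C_1$, $C_2$ are connected, and there is a globally Lipschitz function $h:\Pi\to\mathbf{R}$, which is a difference of two finite convex functions on $\Pi$, such that $$\Sigma=\{p+h(p)v\mid p\in\Pi\},\quad C_1=\{p+tv\mid p\in\Pi,\ t>h(p)\},\quad C_2=\{p+tv\mid p\in\Pi,\ t<h(p)\}.$$ (3) If $\operatorname{spt}\mu$ is convex and $\overline\Omega_i$ is connected for $i=1$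 or $i=2$, then $\operatorname{spt}\mu\cap(C_i\cup\Sigma)$ is connected for that $i$. -/

import Mathlib

open MeasureTheory Set
open scoped NNReal

noncomputable section

namespace DCTears

/-- Euclidean space `ℝⁿ`. -/
abbrev E (n : ℕ) : Type := EuclideanSpace ℝ (Fin n)

/-- The cost `c(x, y) = -⟨x, y⟩`. -/
def cost {n : ℕ} (x y : E n) : ℝ := -inner ℝ x y

/-- `T` is a (Borel) map pushing `μ` forward to `ν` and minimizing the transport cost among
all such maps. -/
structure IsOptimalMap {n : ℕ} (μ ν : Measure (E n)) (T : E n → E n) : Prop where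
  measurePreserving : MeasurePreserving T μ ν
  le : ∀ S : E n → E n, MeasurePreserving S μ ν →
    ∫ x, cost x (T x) ∂μ ≤ ∫ x, cost x (S x) ∂μ

/-- `u` is an optimal potential transporting `μ` to `ν` with cost `-⟨x, y⟩`: a finite convex
function on `ℝⁿ`, differentiable almost everywhere, whose gradient is an optimal map from `μ` to
`ν` and takes values in `spt ν` at all points where it exists. (The Mathlib gradient is `0` where
`u` is not differentiable; this concerns a Lebesgue null set only.) -/
structure IsOptimalPotential {n : ℕ} (μ ν : Measure (E n)) (u : E n → ℝ) : Prop where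
  convexOn : ConvexOn ℝ univ u
  ae_differentiableAt : ∀ᵐ x, DifferentiableAt ℝ u x
  isOptimalMap : IsOptimalMap μ ν (gradient u)
  gradient_mem : ∀ x, DifferentiableAt ℝ u x → gradient u x ∈ ν.support

/-- The subdifferential of a finite convex function at `x₀`. -/
def subdiff {n : ℕ} (u : E n → ℝ) (x₀ : E n) : Set (E n) :=
  {p | ∀ x, inner ℝ (x - x₀) p + u x₀ ≤ u x}

/-- The hyperplane `{⟨x, v⟩ = a}`. -/
def hyperplane {n : ℕ} (v : E n) (a : ℝ) : Set (E n) := {x | inner ℝ x v = a}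

/-- The hyperplane `{⟨x, v⟩ = a}` with unit normal `v` strongly separates `A` and `B`,
with `v` pointing from `A` towards `B`. -/
def StronglySeparates {n : ℕ} (v : E n) (a : ℝ) (A B : Set (E n)) : Prop :=
  ‖v‖ = 1 ∧ ∃ d : ℝ, 0 < d ∧
    ∀ x₁ ∈ A, ∀ x₂ ∈ B, inner ℝ x₁ v < a - d ∧ a + d < inner ℝ x₂ v

/-- `h` is a difference of two finite convex functions on `P`. -/
def IsDCOn {n : ℕ} (P : Set (E n)) (h : E n → ℝ) : Prop :=
  ∃ f g : E n → ℝ, ConvexOn ℝ P f ∧ ConvexOn ℝ P g ∧ ∀ p ∈ P, h p = f p - g p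

/-- The graph of `h : P → ℝ` in the direction `v`. -/
def graphOver {n : ℕ} (v : E n) (P : Set (E n)) (h : E n → ℝ) : Set (E n) :=
  {x | ∃ p ∈ P, x = p + h p • v}

/-- The open epigraph of `h : P → ℝ` in the direction `v`. -/
def openEpigraphOver {n : ℕ} (v : E n) (P : Set (E n)) (h : E n → ℝ) : Set (E n) :=
  {x | ∃ p ∈ P, ∃ t : ℝ, h p < t ∧ x = p + t • v}

/-- The open subgraph of `h : P → ℝ` in the direction `v`. -/
def openSubgraphOver {n : ℕ} (v : E n) (P : Set (E n)) (h : E n → ℝ) : Set (E n) :=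
  {x | ∃ p ∈ P, ∃ t : ℝ, t < h p ∧ x = p + t • v}

/-- The tear `Σ`: points whose subdifferential meets both pieces. -/
def tear {n : ℕ} (u : E n → ℝ) (Ω₁ Ω₂ : Set (E n)) : Set (E n) :=
  {x | (subdiff u x ∩ Ω₁).Nonempty ∧ (subdiff u x ∩ Ω₂).Nonempty}

/-- The points whose subdifferential misses the piece `Ω'`; so `C₁ = missing u Ω₂` and
`C₂ = missing u Ω₁`. -/
def missing {n : ℕ} (u : E n → ℝ) (Ω' : Set (E n)) : Set (E n) :=
  {x | subdiff u x ∩ Ω' = ∅}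

end DCTears

end

namespace DCTears

variable {n : ℕ}

/-! ### Subgradients -/

/-! Existence is Kantorovich duality: minimize `∫ ψ* dμ + ∫ ψ dν` over continuous `ψ` on `spt ν`.
Replacing `ψ` by the transform of `ψ*` restricted to `spt μ` does not raise the functional and gives
a Lipschitz constant depending only on `spt μ`, so Arzelà–Ascoli yields a minimizer
(`exists_dual_minimizer`). Its first variation says that `∇ψ*` pushes `μ` to `ν`
(`integral_gradient_le_of_minimizer`), and Fenchel–Young gives optimality (`isOptimalMap_gradient`).

For the structure, every point of `spt ν` is a subgradient of `u` somewhere on `spt μ`, so each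
piece `Ωᵢ` supplies affine minorants of `u`; their supremum `wᵢ` touches `u` exactly where `∂u`
meets `Ωᵢ` (`exists_part`). A gradient of `u` lies in one of the pieces, so `u = max w₁ w₂` on a
dense set, hence everywhere, and `Σ`, `C₁`, `C₂` amount to comparing `w₁` with `w₂`. Along `v`, `w₁`
rises at rate at least `a + d` and `w₂` at rate at most `a - d`, so `w₁ - w₂` has a single zero on
each line: the height `h`. For every `s ∈ [a - d, a + d]` the convex function `inf_t (u (p + t v) -
s t)` is attained at `t = h p`; two values of `s` exhibit `h` as a difference of convex functions.

For (3), the closed relation `q ∈ ∂u(x)` on `spt μ` has nonempty convex fibres over `Ωᵢ`, which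
transfers connectedness from `Ωᵢ` to its preimage. -/

lemma gradient_mem_subdiff {u : E n → ℝ} (hu : ConvexOn ℝ univ u) {x : E n}
    (hx : DifferentiableAt ℝ u x) : gradient u x ∈ subdiff u x := by
  intro y
  have hg : ConvexOn ℝ univ (fun t : ℝ => u (AffineMap.lineMap x y t)) := by
    have h := hu.comp_affineMap (AffineMap.lineMap x y : ℝ →ᵃ[ℝ] E n)
    rw [preimage_univ] at h
    exact h
  have hd : HasDerivAt (fun t : ℝ => u (AffineMap.lineMap x y t)) (fderiv ℝ u x (y - x)) 0 := by
    have h1 : HasDerivAt (fun t : ℝ => (AffineMap.lineMap x y t : E n)) (y - x) 0 :=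
      AffineMap.hasDerivAt_lineMap
    have h2 : HasFDerivAt u (fderiv ℝ u x) (AffineMap.lineMap x y (0 : ℝ)) := by
      simpa using hx.hasFDerivAt
    exact h2.comp_hasDerivAt 0 h1
  have := hg.le_slope_of_hasDerivAt (mem_univ 0) (mem_univ 1) zero_lt_one hd
  simp only [slope_def_field, AffineMap.lineMap_apply_one, AffineMap.lineMap_apply_zero,
    sub_zero, div_one] at this
  have h3 : inner ℝ (y - x) (gradient u x) = fderiv ℝ u x (y - x) := by
    rw [real_inner_comm, gradient, InnerProductSpace.toDual_symm_apply]
  linarith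

/-- A subgradient `p` makes `u - ⟨p, ·⟩` minimal at `x`, so its derivative vanishes there. -/
lemma eq_gradient_of_mem_subdiff {u : E n → ℝ} {x p : E n}
    (hx : DifferentiableAt ℝ u x) (hp : p ∈ subdiff u x) : p = gradient u x := by
  have hmin : IsLocalMin (fun y => u y - innerSL ℝ p y) x := by
    refine Filter.Eventually.of_forall fun y => ?_
    have := hp y
    rw [inner_sub_left] at this
    simp only [innerSL_apply_apply]
    rw [real_inner_comm y p, real_inner_comm x p]
    linarith
  have h := hmin.hasFDerivAt_eq_zero (hx.hasFDerivAt.sub (innerSL ℝ p).hasFDerivAt)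
  rw [gradient, eq_comm, LinearIsometryEquiv.symm_apply_eq, sub_eq_zero.1 h]
  rfl

lemma convexOn_of_subdiff_nonempty {u : E n → ℝ} (hu : ∀ x, (subdiff u x).Nonempty) :
    ConvexOn ℝ univ u := by
  refine ⟨convex_univ, fun x _ y _ s t hs ht hst => ?_⟩
  obtain ⟨p, hp⟩ := hu (s • x + t • y)
  have hx := mul_le_mul_of_nonneg_left (hp x) hs
  have hy := mul_le_mul_of_nonneg_left (hp y) ht
  simp only [inner_sub_left, inner_add_left, real_inner_smul_left] at hx hy
  simp only [smul_eq_mul]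
  obtain rfl : t = 1 - s := by linarith
  linarith

lemma lipschitzWith_of_subdiff {u : E n → ℝ} {R : ℝ}
    (hu : ∀ x, ∃ p ∈ subdiff u x, ‖p‖ ≤ R) : LipschitzWith R.toNNReal u := by
  refine LipschitzWith.of_le_add_mul _ fun x y => ?_
  obtain ⟨p, hp, hpR⟩ := hu x
  have h1 := hp y
  have h2 := abs_real_inner_le_norm (y - x) p
  have h3 : ‖y - x‖ * ‖p‖ ≤ ‖y - x‖ * R.toNNReal := by
    gcongr
    exact hpR.trans (Real.le_coe_toNNReal R)
  rw [dist_comm, dist_eq_norm]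
  have := neg_abs_le (inner ℝ (y - x) p)
  linarith

lemma exists_lipschitzWith_of_subdiff {u : E n → ℝ} {K : Set (E n)}
    (hK : Bornology.IsBounded K) (hu : ∀ x, (subdiff u x ∩ K).Nonempty) :
    ∃ C : ℝ≥0, LipschitzWith C u := by
  obtain ⟨R, hR⟩ := hK.exists_norm_le
  exact ⟨R.toNNReal, lipschitzWith_of_subdiff fun x =>
    (hu x).imp fun p hp => ⟨hp.1, hR p hp.2⟩⟩

lemma gradient_mem_of_subdiff {u : E n → ℝ} {K : Set (E n)}
    (hu : ∀ x, (subdiff u x ∩ K).Nonempty) {x : E n} (hx : DifferentiableAt ℝ u x) :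
    gradient u x ∈ K := by
  obtain ⟨p, hp, hpK⟩ := hu x
  rwa [← eq_gradient_of_mem_subdiff hx hp]

lemma isClosed_graph_subdiff {u : E n → ℝ} (hu : Continuous u) :
    IsClosed {z : E n × E n | z.2 ∈ subdiff u z.1} := by
  have : {z : E n × E n | z.2 ∈ subdiff u z.1} =
      ⋂ y, {z | inner ℝ (y - z.1) z.2 + u z.1 ≤ u y} := by
    ext z; simp [subdiff]
  rw [this]
  exact isClosed_iInter fun y => isClosed_le (by fun_prop) (by fun_prop)

/-- The points at which `q` is a subgradient of a convex function form a convex set. -/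
lemma convex_setOf_mem_subdiff {u : E n → ℝ} (hu : ConvexOn ℝ univ u) (q : E n) :
    Convex ℝ {x | q ∈ subdiff u x} := by
  intro x hx y hy s t hs ht hst z
  have h := hu.2 (mem_univ x) (mem_univ y) hs ht hst
  have h1 := mul_le_mul_of_nonneg_left (hx z) hs
  have h2 := mul_le_mul_of_nonneg_left (hy z) ht
  simp only [inner_sub_left, inner_add_left, real_inner_smul_left, smul_eq_mul] at *
  obtain rfl : t = 1 - s := by linarith
  linarith

/-! ### The part of a potential with subgradients in a given compact set -/

/-- The largest function below `u` which is a supremum of affine functions with slopes in `Ω`: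
it has a subgradient in `Ω` everywhere, and it touches `u` precisely where `u` itself has one. -/
lemma exists_part {u : E n → ℝ} {Ω : Set (E n)} (hΩ : IsCompact Ω) {x₀ : E n}
    (hx₀ : (subdiff u x₀ ∩ Ω).Nonempty) :
    ∃ w : E n → ℝ, (∀ x, w x ≤ u x) ∧ (∀ x, (subdiff w x ∩ Ω).Nonempty) ∧
      ∀ x, w x = u x ↔ (subdiff u x ∩ Ω).Nonempty := by
  obtain ⟨p₀, hp₀, hp₀Ω⟩ := hx₀
  -- A pair `(p, c)` encodes the affine minorant `⟨·, p⟩ - c` of `u` with slope in `Ω`.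
  set A : Set (E n × ℝ) := {z | z.1 ∈ Ω ∧ ∀ y, inner ℝ y z.1 - z.2 ≤ u y} with hA
  have hAclosed : IsClosed A := by
    have : A = {z | z.1 ∈ Ω} ∩ ⋂ y, {z : E n × ℝ | inner ℝ y z.1 - z.2 ≤ u y} := by
      ext z; simp [hA]
    rw [this]
    exact (hΩ.isClosed.preimage continuous_fst).inter
      (isClosed_iInter fun y => isClosed_le (by fun_prop) (by fun_prop))
  set c₀ := inner ℝ x₀ p₀ - u x₀ with hc₀
  have h₀ : (p₀, c₀) ∈ A := ⟨hp₀Ω, fun y => by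
    have := hp₀ y
    simp only [inner_sub_left, hc₀] at *
    linarith⟩
  have hmax : ∀ x, ∃ z ∈ A, ∀ z' ∈ A, inner ℝ x z'.1 - z'.2 ≤ inner ℝ x z.1 - z.2 := by
    intro x
    obtain ⟨M, hM⟩ := (hΩ.image (f := fun p => (inner ℝ x p : ℝ)) (by fun_prop)).bddAbove
    have hMp : ∀ p ∈ Ω, inner ℝ x p ≤ M := fun p hp => hM ⟨p, hp, rfl⟩
    -- Only minorants at least as good at `x` as the given one matter. This bounds `c` above, while
    -- the minorant inequality at `0` bounds it below, so a best one exists by compactness.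
    set B := A ∩ {z | inner ℝ x p₀ - c₀ ≤ inner ℝ x z.1 - z.2} with hB
    have hBc : IsCompact B := by
      refine (hΩ.prod (isCompact_Icc (a := -u 0) (b := M - (inner ℝ x p₀ - c₀)))).of_isClosed_subset
        (hAclosed.inter (isClosed_le (by fun_prop) (by fun_prop))) ?_
      rintro ⟨p, c⟩ ⟨⟨hp, hpc⟩, hc⟩
      have h0 := hpc 0
      have h1 := hMp p hp
      simp only [inner_zero_left, zero_sub, mem_ofPred_eq] at h0 hc
      exact ⟨hp, by simp only; linarith, by simp only; linarith⟩
    obtain ⟨z, hz, hzmax⟩ := hBc.exists_isMaxOn ⟨(p₀, c₀), h₀, le_refl (inner ℝ x p₀ - c₀)⟩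
      (f := fun z : E n × ℝ => inner ℝ x z.1 - z.2) (by fun_prop)
    refine ⟨z, hz.1, fun z' hz' => ?_⟩
    rcases le_total (inner ℝ x p₀ - c₀) (inner ℝ x z'.1 - z'.2) with h | h
    · exact hzmax ⟨hz', h⟩
    · exact h.trans hz.2
  choose f hfA hf using hmax
  refine ⟨fun x => inner ℝ x (f x).1 - (f x).2, fun x => (hfA x).2 x, fun x =>
    ⟨(f x).1, fun y => ?_, (hfA x).1⟩, fun x => ⟨fun h => ?_, ?_⟩⟩
  · have := hf y (f x) (hfA x)
    simp only [inner_sub_left]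
    linarith
  · refine ⟨(f x).1, fun y => ?_, (hfA x).1⟩
    have := (hfA x).2 y
    simp only [inner_sub_left] at *
    linarith
  · rintro ⟨p, hp, hpΩ⟩
    refine le_antisymm ((hfA x).2 x) ?_
    have := hf x (p, inner ℝ x p - u x) ⟨hpΩ, fun y => by
      have := hp y
      simp only [inner_sub_left] at *
      linarith⟩
    simp only at this
    linarith

/-- Every point of `spt ν` is a subgradient of an optimal potential at a point of `spt μ`. -/
lemma IsOptimalPotential.exists_mem_subdiff {μ ν : Measure (E n)} {u : E n → ℝ}
    (hu : IsOptimalPotential μ ν u) (hμ : μ ≪ volume) (hμb : IsCompact μ.support) {q : E n}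
    (hq : q ∈ ν.support) : ∃ x ∈ μ.support, q ∈ subdiff u x := by
  have hcont : Continuous u := hu.convexOn.locallyLipschitz.continuous
  set Q : Set (E n) := {q | ∃ x ∈ μ.support, q ∈ subdiff u x} with hQ
  have hQc : IsClosed Q := by
    have : CompactSpace μ.support := isCompact_iff_compactSpace.1 hμb
    have h := isClosedMap_snd_of_compactSpace (X := μ.support) (Y := E n) _
      ((isClosed_graph_subdiff hcont).preimage
        (f := fun z : μ.support × E n => ((z.1 : E n), z.2)) (by fun_prop))
    convert h using 1
    ext q
    simp [hQ]
  -- A closed set of full `ν`-measure contains the support; `Q` has full measure because it contains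
  -- `∇u(x)` for `μ`-almost every `x`.
  refine Measure.support_subset_of_isClosed hQc ?_ hq
  have hT := hu.isOptimalMap.measurePreserving
  rw [← hT.map_eq, mem_ae_map_iff hT.measurable.aemeasurable hQc.measurableSet]
  filter_upwards [Measure.support_mem_ae, hμ.ae_le hu.ae_differentiableAt] with x hx hd
  exact ⟨x, hx, gradient_mem_subdiff hu.convexOn hd⟩

/-- A closed relation with compact first factor, whose fibres over a connected set are nonempty
and connected, relates this set to a connected set. -/
lemma isConnected_of_fibers {X Y : Type*} [TopologicalSpace X] [TopologicalSpace Y]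
    {K : Set X} (hK : IsCompact K) {Ω : Set Y} (hΩ : IsConnected Ω)
    {G : Set (X × Y)} (hG : IsClosed G)
    (hfib : ∀ q ∈ Ω, IsConnected {x | x ∈ K ∧ (x, q) ∈ G}) :
    IsConnected {x | x ∈ K ∧ ∃ q ∈ Ω, (x, q) ∈ G} := by
  constructor
  · obtain ⟨q, hq⟩ := hΩ.nonempty
    obtain ⟨x, hx, hxq⟩ := (hfib q hq).nonempty
    exact ⟨x, hx, q, hq, hxq⟩
  have hclosed : ∀ s : Set X, IsClosed s → IsClosed {q | ∃ x ∈ K, x ∈ s ∧ (x, q) ∈ G} := by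
    intro s hs
    have : CompactSpace K := isCompact_iff_compactSpace.1 hK
    have h := isClosedMap_snd_of_compactSpace (X := K) (Y := Y) _
      (((hs.preimage continuous_fst).inter hG).preimage
        (f := fun z : K × Y => ((z.1 : X), z.2)) (by fun_prop))
    convert h using 1
    ext q
    constructor
    · rintro ⟨x, hx, hxs, hxq⟩
      exact ⟨(⟨x, hx⟩, q), ⟨hxs, hxq⟩, rfl⟩
    · rintro ⟨⟨x, q⟩, ⟨hxs, hxq⟩, rfl⟩
      exact ⟨x, x.2, hxs, hxq⟩
  -- A closed cover `s`, `t` projects to a closed cover of `Ω`. Connectedness of `Ω` gives a fibre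
  -- meeting both `s` and `t`, and connectedness of that fibre gives a common point.
  rw [isPreconnected_closed_iff]
  rintro s t hs ht hst ⟨x, ⟨hxK, q, hq, hxq⟩, hxs⟩ ⟨y, ⟨hyK, r, hr, hyr⟩, hyt⟩
  obtain ⟨z, hzΩ, ⟨b, hbK, hbs, hbz⟩, c, hcK, hct, hcz⟩ :=
    isPreconnected_closed_iff.1 hΩ.isPreconnected _ _ (hclosed s hs) (hclosed t ht)
    (fun z hz => by
      obtain ⟨b, hbK, hbz⟩ := (hfib z hz).nonempty
      rcases hst ⟨hbK, z, hz, hbz⟩ with h | h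
      · exact Or.inl ⟨b, hbK, h, hbz⟩
      · exact Or.inr ⟨b, hbK, h, hbz⟩)
    ⟨q, hq, x, hxK, hxs, hxq⟩ ⟨r, hr, y, hyK, hyt, hyr⟩
  obtain ⟨e, ⟨heK, hez⟩, hest⟩ :=
    isPreconnected_closed_iff.1 (hfib z hzΩ).isPreconnected s t hs ht
    (fun e he => hst ⟨he.1, z, hzΩ, he.2⟩) ⟨b, ⟨hbK, hbz⟩, hbs⟩ ⟨c, ⟨hcK, hcz⟩, hct⟩
  exact ⟨e, ⟨heK, z, hzΩ, hez⟩, hest⟩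

/-- The part of `spt μ` that is transported to a connected piece of `spt ν` is connected. -/
lemma IsOptimalPotential.isConnected_support_inter {μ ν : Measure (E n)} {u : E n → ℝ}
    (hu : IsOptimalPotential μ ν u) (hμ : μ ≪ volume) (hμb : IsCompact μ.support)
    (hconv : Convex ℝ μ.support) {Ω : Set (E n)} (hΩ : IsConnected Ω) (hΩν : Ω ⊆ ν.support) :
    IsConnected (μ.support ∩ {x | (subdiff u x ∩ Ω).Nonempty}) := by
  have hcont : Continuous u := hu.convexOn.locallyLipschitz.continuous
  convert isConnected_of_fibers hμb hΩ (isClosed_graph_subdiff hcont) fun q hq => ?_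
    using 1
  · ext x
    simp only [mem_inter_iff, mem_ofPred_eq, Set.Nonempty, and_congr_right_iff]
    exact fun _ => exists_congr fun q => and_comm
  · obtain ⟨x, hx, hxq⟩ := hu.exists_mem_subdiff hμ hμb (hΩν hq)
    exact (hconv.inter (convex_setOf_mem_subdiff hu.convexOn q)).isConnected ⟨x, hx, hxq⟩

/-! ### The tear as a graph -/

lemma add_mul_le_of_subdiff {w : E n → ℝ} {v : E n} {b : ℝ}
    (hw : ∀ x, ∃ p ∈ subdiff w x, b ≤ inner ℝ p v) (x : E n) {t : ℝ} (ht : 0 ≤ t) :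
    w x + t * b ≤ w (x + t • v) := by
  obtain ⟨p, hp, hb⟩ := hw x
  have h := hp (x + t • v)
  rw [add_sub_cancel_left, real_inner_smul_left, real_inner_comm] at h
  have := mul_le_mul_of_nonneg_left hb ht
  linarith

/-- The upper bound on the increment comes from the subgradient at the far end of the segment,
whereas the lower bound uses the one at the near end. -/
lemma le_add_mul_of_subdiff {w : E n → ℝ} {v : E n} {b : ℝ}
    (hw : ∀ x, ∃ p ∈ subdiff w x, inner ℝ p v ≤ b) (x : E n) {t : ℝ} (ht : 0 ≤ t) :
    w (x + t • v) ≤ w x + t * b := by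
  obtain ⟨p, hp, hb⟩ := hw (x + t • v)
  have h := hp x
  rw [sub_add_cancel_left, inner_neg_left, real_inner_smul_left, real_inner_comm] at h
  have := mul_le_mul_of_nonneg_left hb ht
  linarith

/-- If the slopes of `w₁` in the direction `v` are at least `a + d` and those of `w₂` at most
`a - d`, then the coincidence set of `w₁` and `w₂` is a graph over the points of the space. -/
lemma exists_height {w₁ w₂ : E n → ℝ} {v : E n} {a d : ℝ} (hd : 0 < d)
    (hc₁ : Continuous w₁) (hc₂ : Continuous w₂)
    (h₁ : ∀ x, ∃ p ∈ subdiff w₁ x, a + d ≤ inner ℝ p v)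
    (h₂ : ∀ x, ∃ p ∈ subdiff w₂ x, inner ℝ p v ≤ a - d) :
    ∃ h : E n → ℝ, ∀ p t,
      (w₁ (p + t • v) = w₂ (p + t • v) ↔ t = h p) ∧
      (w₂ (p + t • v) < w₁ (p + t • v) ↔ h p < t) ∧
      (w₁ (p + t • v) < w₂ (p + t • v) ↔ t < h p) := by
  set g : E n → ℝ → ℝ := fun p t => w₁ (p + t • v) - w₂ (p + t • v) with hg
  have hgrow : ∀ p s t, s ≤ t → g p s + 2 * d * (t - s) ≤ g p t := by
    intro p s t hst
    have e : p + t • v = p + s • v + (t - s) • v := by module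
    have k₁ := add_mul_le_of_subdiff h₁ (p + s • v) (sub_nonneg.2 hst)
    have k₂ := le_add_mul_of_subdiff h₂ (p + s • v) (sub_nonneg.2 hst)
    simp only [hg, e]
    linarith
  have hmono : ∀ p, StrictMono (g p) := by
    intro p s t hst
    have := hgrow p s t hst.le
    have := mul_pos hd (sub_pos.2 hst)
    linarith
  have hsurj : ∀ p, Function.Surjective (g p) := by
    intro p
    refine Continuous.surjective (by fun_prop) ?_ ?_
    · refine Filter.tendsto_atTop_mono' _ (f₁ := fun t => g p 0 + 2 * d * t) ?_ ?_
      · filter_upwards [Filter.eventually_ge_atTop 0] with t ht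
        simpa using hgrow p 0 t ht
      · exact Filter.tendsto_atTop_add_const_left _ _
          (Filter.tendsto_id.const_mul_atTop (by positivity))
    · refine Filter.tendsto_atBot_mono' _ (f₂ := g p)
        (f₁ := fun t => g p 0 + 2 * d * t) ?_ ?_
      · filter_upwards [Filter.eventually_le_atBot 0] with t ht
        have := hgrow p t 0 ht
        linarith
      · exact Filter.tendsto_atBot_add_const_left _ _
          (Filter.tendsto_id.const_mul_atBot (by positivity))
  choose h hh using fun p => hsurj p 0
  refine ⟨h, fun p t => ⟨?_, ?_, ?_⟩⟩
  · rw [← (hmono p).injective.eq_iff (a := t), hh, hg, sub_eq_zero]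
  · rw [← (hmono p).lt_iff_lt (b := t), hh, hg, sub_pos]
  · rw [← (hmono p).lt_iff_lt (a := t), hh, hg, sub_neg]

/-- Raising the height over `q` from `h q` to `h p` opens a gap `w₁ - w₂` of at least `2d (h p - h
q)`. At that height the gap over `p` is zero, and the gap is `(L₁ + L₂)`-Lipschitz. -/
lemma exists_lipschitzWith_height {w₁ w₂ h : E n → ℝ} {v : E n} {a d : ℝ} (hd : 0 < d)
    {L₁ L₂ : ℝ≥0} (hL₁ : LipschitzWith L₁ w₁) (hL₂ : LipschitzWith L₂ w₂)
    (h₁ : ∀ x, ∃ p ∈ subdiff w₁ x, a + d ≤ inner ℝ p v)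
    (h₂ : ∀ x, ∃ p ∈ subdiff w₂ x, inner ℝ p v ≤ a - d)
    (hh : ∀ p, w₁ (p + h p • v) = w₂ (p + h p • v)) :
    ∃ K : ℝ≥0, LipschitzWith K h := by
  refine ⟨((L₁ + L₂) / (2 * d)).toNNReal, LipschitzWith.of_le_add_mul _ fun p q => ?_⟩
  rw [Real.coe_toNNReal _ (by positivity)]
  rcases le_total (h p) (h q) with hpq | hpq
  · have : 0 ≤ (L₁ + L₂ : ℝ) / (2 * d) * dist p q := by positivity
    linarith
  have e : q + h p • v = q + h q • v + (h p - h q) • v := by module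
  have k₁ := add_mul_le_of_subdiff h₁ (q + h q • v) (sub_nonneg.2 hpq)
  have k₂ := le_add_mul_of_subdiff h₂ (q + h q • v) (sub_nonneg.2 hpq)
  rw [← e] at k₁ k₂
  have m₁ := hL₁.le_add_mul (q + h p • v) (p + h p • v)
  have m₂ := hL₂.le_add_mul (p + h p • v) (q + h p • v)
  rw [dist_add_right] at m₁ m₂
  rw [dist_comm q p] at m₁
  have e₁ := hh p
  have e₂ := hh q
  rw [← sub_le_iff_le_add', div_mul_eq_mul_div, le_div_iff₀ (by positivity)]
  linarith

/-- With `u = max w₁ w₂`, tilting `u` along `v` by a slope in `[a - d, a + d]` and minimizing in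
the direction `v` gives a convex function; the minimum is attained at the height `h`. -/
lemma convexOn_tilted_height {u w₁ w₂ h : E n → ℝ} {v : E n} {a d s : ℝ}
    (hu : ConvexOn ℝ univ u) (hle₁ : ∀ x, w₁ x ≤ u x) (hle₂ : ∀ x, w₂ x ≤ u x)
    (h₁ : ∀ x, ∃ p ∈ subdiff w₁ x, a + d ≤ inner ℝ p v)
    (h₂ : ∀ x, ∃ p ∈ subdiff w₂ x, inner ℝ p v ≤ a - d)
    (hh₁ : ∀ p, w₁ (p + h p • v) = u (p + h p • v))
    (hh₂ : ∀ p, w₂ (p + h p • v) = u (p + h p • v)) (hs : s ∈ Icc (a - d) (a + d)) :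
    ConvexOn ℝ univ fun p => u (p + h p • v) - s * h p := by
  -- Above `h p`, `u ≥ w₁` rises at rate at least `a + d ≥ s`; below it, `u ≥ w₂` is controlled by
  -- the rate `a - d ≤ s`.
  have hmin : ∀ p t, u (p + h p • v) - s * h p ≤ u (p + t • v) - s * t := by
    intro p t
    rcases le_total (h p) t with ht | ht
    · have k := add_mul_le_of_subdiff h₁ (p + h p • v) (sub_nonneg.2 ht)
      rw [show p + h p • v + (t - h p) • v = p + t • v by module, hh₁] at k
      have := hle₁ (p + t • v)
      have := mul_le_mul_of_nonneg_left hs.2 (sub_nonneg.2 ht)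
      linarith
    · have k := le_add_mul_of_subdiff h₂ (p + t • v) (sub_nonneg.2 ht)
      rw [show p + t • v + (h p - t) • v = p + h p • v by module, hh₂] at k
      have := hle₂ (p + t • v)
      have := mul_le_mul_of_nonneg_left hs.1 (sub_nonneg.2 ht)
      linarith
  -- Partial minimization preserves convexity: the averaged height serves as competitor over the
  -- averaged base point.
  refine ⟨convex_univ, fun p _ q _ α β hα hβ hαβ => (hmin _ (α * h p + β * h q)).trans ?_⟩
  have k := hu.2 (mem_univ (p + h p • v)) (mem_univ (q + h q • v)) hα hβ hαβ
  rw [show α • p + β • q + (α * h p + β * h q) • v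
    = α • (p + h p • v) + β • (q + h q • v) by module]
  simp only [smul_eq_mul] at *
  linarith

lemma convex_hyperplane (v : E n) (a : ℝ) : Convex ℝ (hyperplane v a) := by
  intro x hx y hy s t _ _ hst
  simp only [hyperplane, mem_ofPred_eq, inner_add_left, real_inner_smul_left] at *
  rw [hx, hy, ← add_mul, hst, one_mul]

lemma nonempty_hyperplane {v : E n} (hv : ‖v‖ = 1) (a : ℝ) : (hyperplane v a).Nonempty :=
  ⟨a • v, by simp [hyperplane, real_inner_smul_left, hv]⟩

lemma exists_eq_add_smul {v : E n} (hv : ‖v‖ = 1) (a : ℝ) (x : E n) :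
    ∃ p ∈ hyperplane v a, ∃ t : ℝ, x = p + t • v := by
  refine ⟨x - (inner ℝ x v - a) • v, ?_, inner ℝ x v - a, by module⟩
  simp [hyperplane, inner_sub_left, real_inner_smul_left, hv]

lemma isConnected_graphOver {v : E n} {P : Set (E n)} {h : E n → ℝ} (hP : IsConnected P)
    (hh : Continuous h) : IsConnected (graphOver v P h) := by
  convert hP.image (fun p => p + h p • v) (by fun_prop) using 1
  ext x
  simp [graphOver, eq_comm]

lemma isConnected_openEpigraphOver {v : E n} {P : Set (E n)} {h : E n → ℝ} (hP : IsConnected P)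
    (hh : Continuous h) : IsConnected (openEpigraphOver v P h) := by
  convert (hP.prod (isConnected_Ioi (a := (0 : ℝ)))).image
    (fun z : E n × ℝ => z.1 + (h z.1 + z.2) • v) (by fun_prop) using 1
  ext x
  constructor
  · rintro ⟨p, hp, t, ht, rfl⟩
    exact ⟨(p, t - h p), ⟨hp, sub_pos.2 ht⟩, by simp⟩
  · rintro ⟨⟨p, t⟩, ⟨hp, ht⟩, rfl⟩
    exact ⟨p, hp, h p + t, lt_add_of_pos_right _ ht, rfl⟩

lemma isConnected_openSubgraphOver {v : E n} {P : Set (E n)} {h : E n → ℝ} (hP : IsConnected P)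
    (hh : Continuous h) : IsConnected (openSubgraphOver v P h) := by
  convert (hP.prod (isConnected_Iio (a := (0 : ℝ)))).image
    (fun z : E n × ℝ => z.1 + (h z.1 + z.2) • v) (by fun_prop) using 1
  ext x
  constructor
  · rintro ⟨p, hp, t, ht, rfl⟩
    exact ⟨(p, t - h p), ⟨hp, sub_neg.2 ht⟩, by simp⟩
  · rintro ⟨⟨p, t⟩, ⟨hp, ht⟩, rfl⟩
    exact ⟨p, hp, h p + t, add_lt_of_neg_right _ ht, rfl⟩

/-! ### Splitting a potential along the pieces of the target -/

/-- A potential splits into two convex parts with subgradients in the two pieces of the target. -/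
lemma IsOptimalPotential.exists_split {μ ν : Measure (E n)} {u : E n → ℝ}
    (hu : IsOptimalPotential μ ν u) (hμ : μ ≪ volume) (hμb : IsCompact μ.support)
    {Ω₁ Ω₂ : Set (E n)} (hΩ₁ : Ω₁.Nonempty) (hΩ₂ : Ω₂.Nonempty) (hc₁ : IsCompact Ω₁)
    (hc₂ : IsCompact Ω₂) (hsplit : ν.support = Ω₁ ∪ Ω₂) :
    ∃ w₁ w₂ : E n → ℝ, (∀ x, u x = max (w₁ x) (w₂ x)) ∧
      (∀ x, (subdiff w₁ x ∩ Ω₁).Nonempty) ∧ (∀ x, (subdiff w₂ x ∩ Ω₂).Nonempty) ∧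
      (∀ x, w₁ x = u x ↔ (subdiff u x ∩ Ω₁).Nonempty) ∧
      (∀ x, w₂ x = u x ↔ (subdiff u x ∩ Ω₂).Nonempty) := by
  obtain ⟨q₁, hq₁⟩ := hΩ₁
  obtain ⟨q₂, hq₂⟩ := hΩ₂
  obtain ⟨x₁, -, hx₁⟩ := hu.exists_mem_subdiff hμ hμb (hsplit ▸ Or.inl hq₁ : q₁ ∈ ν.support)
  obtain ⟨x₂, -, hx₂⟩ := hu.exists_mem_subdiff hμ hμb (hsplit ▸ Or.inr hq₂ : q₂ ∈ ν.support)
  obtain ⟨w₁, hle₁, hs₁, ht₁⟩ := exists_part hc₁ ⟨q₁, hx₁, hq₁⟩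
  obtain ⟨w₂, hle₂, hs₂, ht₂⟩ := exists_part hc₂ ⟨q₂, hx₂, hq₂⟩
  refine ⟨w₁, w₂, fun x => ?_, hs₁, hs₂, ht₁, ht₂⟩
  obtain ⟨L₁, hL₁⟩ := exists_lipschitzWith_of_subdiff hc₁.isBounded hs₁
  obtain ⟨L₂, hL₂⟩ := exists_lipschitzWith_of_subdiff hc₂.isBounded hs₂
  have hcont : Continuous u := hu.convexOn.locallyLipschitz.continuous
  -- Both sides are continuous, so it suffices to compare them on the dense set where `u` is
  -- differentiable.
  refine congr_fun (Continuous.ext_on (Measure.dense_of_ae hu.ae_differentiableAt) hcont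
    (hL₁.continuous.max hL₂.continuous) fun y hy => ?_) x
  have hg := gradient_mem_subdiff hu.convexOn hy
  have hm := hu.gradient_mem y hy
  rw [hsplit] at hm
  rcases hm with hm | hm
  · rw [← (ht₁ y).2 ⟨_, hg, hm⟩, max_eq_left]
    exact (ht₁ y).2 ⟨_, hg, hm⟩ ▸ hle₂ y
  · rw [← (ht₂ y).2 ⟨_, hg, hm⟩, max_eq_right]
    exact (ht₂ y).2 ⟨_, hg, hm⟩ ▸ hle₁ y

/-- Two sets strongly separated by a hyperplane whose union is compact are compact. -/
lemma StronglySeparates.isCompact {v : E n} {a : ℝ} {A B : Set (E n)} (hA : A.Nonempty)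
    (hB : B.Nonempty) (h : StronglySeparates v a A B) (hAB : IsCompact (A ∪ B)) :
    IsCompact A ∧ IsCompact B := by
  obtain ⟨-, d, hd, hsep⟩ := h
  obtain ⟨x, hx⟩ := hA
  obtain ⟨y, hy⟩ := hB
  constructor
  · have e : A = (A ∪ B) ∩ {x | inner ℝ x v ≤ a} := by
      ext z
      refine ⟨fun hz => ⟨Or.inl hz, ?_⟩, ?_⟩
      · have := (hsep z hz y hy).1
        simp only [mem_ofPred_eq]
        linarith
      · rintro ⟨hz | hz, hz'⟩
        · exact hz
        · have := (hsep x hx z hz).2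
          simp only [mem_ofPred_eq] at hz'
          linarith
    rw [e]
    exact hAB.inter_right (isClosed_le (by fun_prop) (by fun_prop))
  · have e : B = (A ∪ B) ∩ {x | a ≤ inner ℝ x v} := by
      ext z
      refine ⟨fun hz => ⟨Or.inr hz, ?_⟩, ?_⟩
      · have := (hsep x hx z hz).2
        simp only [mem_ofPred_eq]
        linarith
      · rintro ⟨hz | hz, hz'⟩
        · have := (hsep z hz y hy).1
          simp only [mem_ofPred_eq] at hz'
          linarith
        · exact hz
    rw [e]
    exact hAB.inter_right (isClosed_le (by fun_prop) (by fun_prop))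

/-! ### Legendre transforms of functions on compact sets -/

/-- The Legendre transform of a continuous function on a compact set `K`. -/
noncomputable def conj {K : Set (E n)} (ψ : C(K, ℝ)) (x : E n) : ℝ := ⨆ q : K, (inner ℝ x (q : E n) - ψ q)

section conj

variable {K : Set (E n)} [CompactSpace K]

lemma le_conj (ψ : C(K, ℝ)) (x : E n) (q : K) : inner ℝ x (q : E n) - ψ q ≤ conj ψ x :=
  le_ciSup (f := fun q : K => inner ℝ x (q : E n) - ψ q)
    (isCompact_range (by fun_prop)).bddAbove q

lemma exists_conj_eq [Nonempty K] (ψ : C(K, ℝ)) (x : E n) :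
    ∃ q : K, conj ψ x = inner ℝ x (q : E n) - ψ q := by
  obtain ⟨q, -, hq⟩ := isCompact_univ.exists_isMaxOn univ_nonempty
    (f := fun q : K => inner ℝ x (q : E n) - ψ q) (by fun_prop)
  exact ⟨q, le_antisymm (ciSup_le fun r => hq (mem_univ r)) (le_conj ψ x q)⟩

lemma mem_subdiff_conj {ψ : C(K, ℝ)} {x : E n} {q : K}
    (hq : conj ψ x = inner ℝ x (q : E n) - ψ q) : (q : E n) ∈ subdiff (conj ψ) x := by
  intro y
  have := le_conj ψ y q
  rw [inner_sub_left, hq]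
  linarith

lemma subdiff_conj_inter_nonempty [Nonempty K] (ψ : C(K, ℝ)) (x : E n) :
    (subdiff (conj ψ) x ∩ K).Nonempty := by
  obtain ⟨q, hq⟩ := exists_conj_eq ψ x
  exact ⟨q, mem_subdiff_conj hq, q.2⟩

lemma isBounded_of_compactSpace : Bornology.IsBounded K :=
  (isCompact_iff_compactSpace.2 ‹_›).isBounded

lemma continuous_conj [Nonempty K] (ψ : C(K, ℝ)) : Continuous (conj ψ) := by
  obtain ⟨C, hC⟩ := exists_lipschitzWith_of_subdiff isBounded_of_compactSpace
    (subdiff_conj_inter_nonempty ψ)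
  exact hC.continuous

lemma conj_le_conj_add [Nonempty K] {ψ ψ' : C(K, ℝ)} {c : ℝ} (h : ∀ q, ψ' q ≤ ψ q + c)
    (x : E n) : conj ψ x ≤ conj ψ' x + c := by
  obtain ⟨q, hq⟩ := exists_conj_eq ψ x
  have := le_conj ψ' x q
  have := h q
  linarith

lemma conj_le_conj_add_dist [Nonempty K] (ψ ψ' : C(K, ℝ)) (x : E n) :
    conj ψ x ≤ conj ψ' x + dist ψ ψ' := by
  refine conj_le_conj_add (fun q => ?_) x
  have := (abs_le.1 (Real.dist_eq (ψ q) (ψ' q) ▸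
    ContinuousMap.dist_apply_le_dist (f := ψ) (g := ψ') q)).1
  linarith

end conj

/-! ### The dual problem -/

lemma integrable_of_continuous {X : Type*} [TopologicalSpace X] [MeasurableSpace X] [T2Space X]
    [OpensMeasurableSpace X] [HereditarilyLindelofSpace X] {μ : Measure X}
    [IsFiniteMeasure μ] (hμ : IsCompact μ.support) {f : X → ℝ} (hf : Continuous f) :
    Integrable f μ := by
  have := hf.continuousOn.integrableOn_compact hμ (μ := μ)
  rwa [IntegrableOn, Measure.restrict_eq_self_of_ae_mem (s := μ.support) Measure.support_mem_ae] at this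

lemma integrable_continuousMap {K : Set (E n)} [CompactSpace K] {ν : Measure K}
    [IsFiniteMeasure ν] (ψ : C(K, ℝ)) : Integrable ψ ν :=
  ψ.continuous.integrable_of_hasCompactSupport (HasCompactSupport.of_compactSpace ψ)

/-- The functional of the dual transport problem. -/
noncomputable def dualFunctional {K : Set (E n)} (μ : Measure (E n)) (ν : Measure K) (ψ : C(K, ℝ)) : ℝ :=
  ∫ x, conj ψ x ∂μ + ∫ q, ψ q ∂ν

section dual

variable {K : Set (E n)} [CompactSpace K] [Nonempty K] {μ : Measure (E n)}
  [IsProbabilityMeasure μ] {ν : Measure K} [IsProbabilityMeasure ν]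

lemma dualFunctional_le_of_le (hμ : IsCompact μ.support) {ψ ψ' : C(K, ℝ)} {b c : ℝ}
    (h : ∀ x ∈ μ.support, conj ψ x ≤ conj ψ' x + b) (h' : ∀ q, ψ q ≤ ψ' q + c) :
    dualFunctional μ ν ψ ≤ dualFunctional μ ν ψ' + (b + c) := by
  have h1 : ∫ x, conj ψ x ∂μ ≤ ∫ x, (conj ψ' x + b) ∂μ := by
    refine integral_mono_ae (integrable_of_continuous hμ (continuous_conj ψ))
      ((integrable_of_continuous hμ (continuous_conj ψ')).add (integrable_const b)) ?_
    filter_upwards [Measure.support_mem_ae] with x hx using h x hx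
  have h2 : ∫ q, ψ q ∂ν ≤ ∫ q, (ψ' q + c) ∂ν :=
    integral_mono (integrable_continuousMap ψ)
      ((integrable_continuousMap ψ').add (integrable_const c)) h'
  rw [integral_add (integrable_of_continuous hμ (continuous_conj ψ')) (integrable_const b)] at h1
  rw [integral_add (integrable_continuousMap ψ') (integrable_const c)] at h2
  simp only [integral_const, probReal_univ, one_smul] at h1 h2
  unfold dualFunctional
  linarith

lemma continuous_dualFunctional (hμ : IsCompact μ.support) :
    Continuous (dualFunctional μ ν) := by
  have : LipschitzWith 2 (dualFunctional μ ν) := by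
    refine LipschitzWith.of_le_add_mul _ fun ψ ψ' => ?_
    have := dualFunctional_le_of_le (ν := ν) (ψ := ψ) (ψ' := ψ') hμ
      (fun x _ => conj_le_conj_add_dist ψ ψ' x) (c := dist ψ ψ') (fun q => by
        have := (abs_le.1 (Real.dist_eq (ψ q) (ψ' q) ▸
          ContinuousMap.dist_apply_le_dist (f := ψ) (g := ψ') q)).2
        linarith)
    simp only [NNReal.coe_ofNat]
    linarith
  exact this.continuous

/-- Uniformly Lipschitz functions on a compact set with a prescribed zero form a compact set. -/
lemma isCompact_setOf_lipschitz {X : Type*} [MetricSpace X] [CompactSpace X] (C : ℝ≥0) (q₀ : X) :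
    IsCompact {ψ : C(X, ℝ) | LipschitzWith C ψ ∧ ψ q₀ = 0} := by
  refine ArzelaAscoli.isCompact_of_equicontinuous _ ?_ ?_
  · have e : (ContinuousMap.toFun '' {ψ : C(X, ℝ) | LipschitzWith C ψ ∧ ψ q₀ = 0}) =
        {f : X → ℝ | LipschitzWith C f ∧ f q₀ = 0} := by
      ext f
      constructor
      · rintro ⟨ψ, hψ, rfl⟩
        exact hψ
      · intro hf
        exact ⟨⟨f, hf.1.continuous⟩, hf, rfl⟩
    rw [e]
    refine (isCompact_univ_pi fun q : X => isCompact_Icc (a := -(C * dist q q₀))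
      (b := C * dist q q₀)).of_isClosed_subset ?_ ?_
    · have e' : {f : X → ℝ | LipschitzWith C f ∧ f q₀ = 0} =
          (⋂ p : X × X, {f | dist (f p.1) (f p.2) ≤ C * dist p.1 p.2}) ∩ {f | f q₀ = 0} := by
        ext f
        simp [lipschitzWith_iff_dist_le_mul]
      rw [e']
      exact (isClosed_iInter fun p => isClosed_le (by fun_prop) (by fun_prop)).inter
        (isClosed_eq (by fun_prop) (by fun_prop))
    · rintro f ⟨hf, hf0⟩ q -
      have := hf.dist_le_mul q q₀
      rw [hf0, Real.dist_eq, sub_zero] at this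
      exact abs_le.1 this
  · exact (LipschitzWith.uniformEquicontinuous _ C fun ψ => ψ.2.1).equicontinuous

/-- Any competitor `ψ'` can be replaced by its double transform `χ` through `spt μ`, normalized to
vanish at `q₀`. As a supremum of affine functions with slopes in `spt μ`, `χ` is Lipschitz with a
uniform constant, so minimizing over a compact class suffices. -/
lemma exists_dual_minimizer (hμ : IsCompact μ.support) :
    ∃ ψ : C(K, ℝ), ∀ ψ', dualFunctional μ ν ψ ≤ dualFunctional μ ν ψ' := by
  obtain ⟨q₀⟩ := ‹Nonempty K›
  have : CompactSpace μ.support := isCompact_iff_compactSpace.1 hμ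
  have : Nonempty μ.support :=
    (Measure.nonempty_support (IsProbabilityMeasure.ne_zero μ)).to_subtype
  obtain ⟨R, hR⟩ := hμ.isBounded.exists_norm_le
  obtain ⟨ψ, hψ, hmin⟩ := (isCompact_setOf_lipschitz R.toNNReal q₀).exists_isMinOn
    ⟨0, LipschitzWith.const' 0, rfl⟩ (continuous_dualFunctional (ν := ν) hμ).continuousOn
  refine ⟨ψ, fun ψ' => ?_⟩
  let φ : C(μ.support, ℝ) := ⟨fun x => conj ψ' x, (continuous_conj ψ').comp continuous_subtype_val⟩
  let c := conj φ q₀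
  have hL : LipschitzWith R.toNNReal (conj φ) := lipschitzWith_of_subdiff fun x =>
    (subdiff_conj_inter_nonempty φ x).imp fun p hp => ⟨hp.1, hR p hp.2⟩
  let χ : C(K, ℝ) := ⟨fun q => conj φ q - c,
    ((continuous_conj φ).comp continuous_subtype_val).sub continuous_const⟩
  have hχ : χ ∈ {ψ : C(K, ℝ) | LipschitzWith R.toNNReal ψ ∧ ψ q₀ = 0} := by
    refine ⟨LipschitzWith.of_dist_le_mul fun p q => ?_, sub_self _⟩
    simpa only [χ, ContinuousMap.coe_mk, dist_sub_right, Subtype.dist_eq] using hL.dist_le_mul (p : E n) q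
  refine (hmin hχ).trans ?_
  -- The normalizing constant cancels because both measures have mass one.
  have := dualFunctional_le_of_le (ν := ν) (ψ := χ) (ψ' := ψ') hμ (b := c) (c := -c)
    (fun x hx => ?_) (fun q => ?_)
  · simpa using this
  · obtain ⟨q, hq⟩ := exists_conj_eq χ x
    have := le_conj φ (q : E n) ⟨x, hx⟩
    rw [real_inner_comm] at this
    simp only [χ, φ, ContinuousMap.coe_mk] at hq this
    linarith
  · obtain ⟨x, hx⟩ := exists_conj_eq φ (q : E n)
    have := le_conj ψ' (x : E n) q
    rw [real_inner_comm] at this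
    simp only [χ, φ, ContinuousMap.coe_mk] at hx ⊢
    linarith

end dual

/-! ### Existence of an optimal potential -/

open Filter Topology in
/-- The derivative of the Legendre transform along a perturbation `η`. -/
lemma tendsto_conj_variation {K : Set (E n)} [CompactSpace K] [Nonempty K] (ψ η : C(K, ℝ))
    {x : E n} (hx : DifferentiableAt ℝ (conj ψ) x) {ε : ℕ → ℝ} (hε : ∀ k, 0 < ε k)
    (hε0 : Tendsto ε atTop (𝓝 0)) (p : K) (hp : (p : E n) = gradient (conj ψ) x) :
    Tendsto (fun k => (conj (ψ + ε k • η) x - conj ψ x) / ε k) atTop (𝓝 (-η p)) := by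
  have hη : ∀ q, |η q| ≤ ‖η‖ := fun q => η.norm_coe_le_norm q
  have huniq : ∀ q : K, conj ψ x = inner ℝ x (q : E n) - ψ q → q = p := fun q hq =>
    Subtype.ext ((eq_gradient_of_mem_subdiff hx (mem_subdiff_conj hq)).trans hp.symm)
  have hpx : conj ψ x = inner ℝ x (p : E n) - ψ p := by
    obtain ⟨q, hq⟩ := exists_conj_eq ψ x
    rwa [← huniq q hq]
  choose q hq using fun k => exists_conj_eq (ψ + ε k • η) x
  simp only [ContinuousMap.add_apply, ContinuousMap.smul_apply, smul_eq_mul] at hq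
  have hlow : ∀ k, conj ψ x - ε k * η p ≤ conj (ψ + ε k • η) x := by
    intro k
    have := le_conj (ψ + ε k • η) x p
    simp only [ContinuousMap.add_apply, ContinuousMap.smul_apply, smul_eq_mul] at this
    linarith
  have hval : Tendsto (fun k => inner ℝ x (q k : E n) - ψ (q k)) atTop (𝓝 (conj ψ x)) := by
    have h1 : Tendsto (fun k => conj ψ x - ε k * (2 * ‖η‖)) atTop (𝓝 (conj ψ x)) := by
      simpa using (hε0.mul_const (2 * ‖η‖)).const_sub (conj ψ x)
    refine tendsto_of_tendsto_of_tendsto_of_le_of_le h1 tendsto_const_nhds (fun k => ?_)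
      fun k => le_conj ψ x (q k)
    have h2 := hlow k
    rw [hq] at h2
    have h3 := mul_le_mul_of_nonneg_left (abs_le.1 (hη p)).2 (hε k).le
    have h4 := mul_le_mul_of_nonneg_left (abs_le.1 (hη (q k))).1 (hε k).le
    simp only
    linarith
  -- The perturbed maximizers are almost optimal for `ψ`, so every cluster point is a maximizer,
  -- hence equals `p`; compactness of `K` gives convergence.
  have hqp : Tendsto q atTop (𝓝 p) := by
    refine le_nhds_of_unique_clusterPt fun r hr => huniq r ?_
    have hF : Continuous fun q : K => inner ℝ x (q : E n) - ψ q := by fun_prop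
    have h1 : MapClusterPt (inner ℝ x (r : E n) - ψ r) atTop
        (fun k => inner ℝ x (q k : E n) - ψ (q k)) :=
      MapClusterPt.continuousAt_comp hF.continuousAt hr
    have : (𝓝 (conj ψ x) ⊓ 𝓝 (inner ℝ x (r : E n) - ψ r)).NeBot :=
      (ClusterPt.mono h1 hval).neBot.mono (by rw [inf_comm])
    exact eq_of_nhds_neBot this
  refine tendsto_of_tendsto_of_tendsto_of_le_of_le tendsto_const_nhds
    ((η.continuous.tendsto p).comp hqp).neg (fun k => ?_) fun k => ?_
  · simp only
    rw [le_div_iff₀ (hε k)]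
    linarith [hlow k]
  · simp only [Function.comp_apply]
    rw [div_le_iff₀ (hε k), hq]
    linarith [le_conj ψ x (q k)]

lemma measurable_gradient (u : E n → ℝ) : Measurable (gradient u) :=
  (InnerProductSpace.toDual ℝ (E n)).symm.continuous.measurable.comp (measurable_fderiv ℝ u)

open Filter Topology in
-- The derivative of the dual functional at a minimizer in direction `η` is nonnegative. One-sided
-- perturbations suffice, since `-η` supplies the reverse inequality.
lemma integral_gradient_le_of_minimizer {K : Set (E n)} [CompactSpace K] [Nonempty K]
    {μ : Measure (E n)} [IsProbabilityMeasure μ] {ν : Measure K} [IsProbabilityMeasure ν]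
    (hμ : μ ≪ volume) (hμb : IsCompact μ.support) {ψ : C(K, ℝ)}
    (hψ : ∀ ψ', dualFunctional μ ν ψ ≤ dualFunctional μ ν ψ')
    (η : BoundedContinuousFunction (E n) ℝ) :
    ∫ x, η (gradient (conj ψ) x) ∂μ ≤ ∫ q : K, η q ∂ν := by
  obtain ⟨C, hC⟩ := exists_lipschitzWith_of_subdiff isBounded_of_compactSpace
    (subdiff_conj_inter_nonempty ψ)
  have hdiff : ∀ᵐ x ∂μ, DifferentiableAt ℝ (conj ψ) x := hμ.ae_le hC.ae_differentiableAt
  let χ : C(K, ℝ) := ⟨fun q => η q, η.continuous.comp continuous_subtype_val⟩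
  let ε : ℕ → ℝ := fun k => 1 / ((k : ℝ) + 1)
  have hε : ∀ k, 0 < ε k := fun k => Nat.one_div_pos_of_nat
  have hε0 : Tendsto ε atTop (𝓝 0) := tendsto_one_div_add_atTop_nhds_zero_nat
  have hint : ∀ ψ' : C(K, ℝ), Integrable (conj ψ') μ := fun ψ' =>
    integrable_of_continuous hμb (continuous_conj ψ')
  have hlim : Tendsto (fun k => ∫ x, (conj (ψ + ε k • χ) x - conj ψ x) / ε k ∂μ) atTop
      (𝓝 (∫ x, -η (gradient (conj ψ) x) ∂μ)) := by
    refine tendsto_integral_of_dominated_convergence (fun _ => ‖χ‖) (fun k => ?_)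
      (integrable_const _) (fun k => ?_) ?_
    · exact (((continuous_conj _).sub (continuous_conj _)).div_const _).aestronglyMeasurable
    · refine Eventually.of_forall fun x => ?_
      have hd : dist (ψ + ε k • χ) ψ = ε k * ‖χ‖ := by
        rw [dist_eq_norm, add_sub_cancel_left, norm_smul, Real.norm_of_nonneg (hε k).le]
      have h1 := conj_le_conj_add_dist (ψ + ε k • χ) ψ x
      have h2 := conj_le_conj_add_dist ψ (ψ + ε k • χ) x
      rw [dist_comm] at h2
      rw [hd] at h1 h2
      rw [Real.norm_eq_abs, abs_div, abs_of_pos (hε k), div_le_iff₀ (hε k), abs_le]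
      constructor <;> linarith
    · filter_upwards [hdiff] with x hx
      exact tendsto_conj_variation ψ χ hx hε hε0
        ⟨_, gradient_mem_of_subdiff (subdiff_conj_inter_nonempty ψ) hx⟩ rfl
  have hge : ∀ k, -∫ q : K, η q ∂ν ≤ ∫ x, (conj (ψ + ε k • χ) x - conj ψ x) / ε k ∂μ := by
    intro k
    have h := hψ (ψ + ε k • χ)
    have e : ∫ q, (ψ + ε k • χ) q ∂ν = ∫ q, ψ q ∂ν + ε k * ∫ q : K, η q ∂ν := by
      rw [← integral_const_mul]
      exact integral_add (integrable_continuousMap ψ)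
        ((integrable_continuousMap χ).const_mul (ε k))
    unfold dualFunctional at h
    rw [integral_div, integral_sub (hint _) (hint _), le_div_iff₀ (hε k)]
    rw [e] at h
    linarith
  have := ge_of_tendsto' hlim hge
  rw [integral_neg] at this
  linarith

/-- The gradient of a convex function is an optimal map from `μ` to its image. -/
lemma isOptimalMap_gradient {μ ν : Measure (E n)} [IsProbabilityMeasure μ]
    [IsProbabilityMeasure ν] (hμb : IsCompact μ.support) (hνb : IsCompact ν.support)
    {u : E n → ℝ} (hu : ConvexOn ℝ univ u) (hdiff : ∀ᵐ x ∂μ, DifferentiableAt ℝ u x)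
    (hT : MeasurePreserving (gradient u) μ ν) : IsOptimalMap μ ν (gradient u) := by
  refine ⟨hT, fun S hS => ?_⟩
  have : CompactSpace μ.support := isCompact_iff_compactSpace.1 hμb
  have : Nonempty μ.support :=
    (Measure.nonempty_support (IsProbabilityMeasure.ne_zero μ)).to_subtype
  have hcont : Continuous u := hu.locallyLipschitz.continuous
  let φ : C(μ.support, ℝ) := ⟨fun x => u x, hcont.comp continuous_subtype_val⟩
  have hφ : Continuous (conj φ) := continuous_conj φ
  have hcomp : ∀ S : E n → E n, MeasurePreserving S μ ν →
      Integrable (fun x => u x + conj φ (S x)) μ ∧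
      ∫ x, (u x + conj φ (S x)) ∂μ = ∫ x, u x ∂μ + ∫ q, conj φ q ∂ν := by
    intro S hS
    have h1 : Integrable u μ := integrable_of_continuous hμb hcont
    have h2 : Integrable (fun x => conj φ (S x)) μ :=
      hS.integrable_comp_of_integrable (integrable_of_continuous hνb hφ)
    refine ⟨h1.add h2, ?_⟩
    rw [integral_add h1 h2, ← hS.map_eq, integral_map hS.measurable.aemeasurable
      hφ.aestronglyMeasurable]
  have hint : Integrable (fun x => inner ℝ x (S x)) μ := by
    obtain ⟨R, hR⟩ := hμb.isBounded.exists_norm_le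
    obtain ⟨R', hR'⟩ := hνb.isBounded.exists_norm_le
    refine Integrable.of_bound (measurable_id.inner hS.measurable).aestronglyMeasurable (R * R') ?_
    have hSν : ∀ᵐ x ∂μ, S x ∈ ν.support := by
      have := Measure.support_mem_ae (μ := ν)
      exact hS.quasiMeasurePreserving.ae this
    filter_upwards [Measure.support_mem_ae (μ := μ), hSν] with x hx hx'
    exact (norm_inner_le_norm _ _).trans
      (mul_le_mul (hR x hx) (hR' _ hx') (norm_nonneg _) ((norm_nonneg _).trans (hR x hx)))
  simp only [cost, integral_neg, neg_le_neg_iff]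
  -- Fenchel–Young, with equality for the gradient; the middle integral depends on the map only
  -- through its image measure `ν`.
  calc ∫ x, inner ℝ x (S x) ∂μ ≤ ∫ x, (u x + conj φ (S x)) ∂μ := by
        refine integral_mono_ae hint (hcomp S hS).1 ?_
        filter_upwards [Measure.support_mem_ae (μ := μ)] with x hx
        have := le_conj φ (S x) ⟨x, hx⟩
        rw [real_inner_comm] at this
        simp only [φ, ContinuousMap.coe_mk] at this ⊢
        linarith
    _ = ∫ x, (u x + conj φ (gradient u x)) ∂μ := by
        rw [(hcomp S hS).2, (hcomp _ hT).2]
    _ = ∫ x, inner ℝ x (gradient u x) ∂μ := by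
        refine integral_congr_ae ?_
        filter_upwards [Measure.support_mem_ae (μ := μ), hdiff] with x hx hd
        have h1 := le_conj φ (gradient u x) ⟨x, hx⟩
        obtain ⟨y, hy⟩ := exists_conj_eq φ (gradient u x)
        have h2 := gradient_mem_subdiff hu hd y
        rw [inner_sub_left] at h2
        rw [real_inner_comm] at h1 hy
        simp only [φ, ContinuousMap.coe_mk] at h1 hy ⊢
        linarith

theorem exists_isOptimalPotential {μ ν : Measure (E n)} [IsProbabilityMeasure μ]
    [IsProbabilityMeasure ν] (hμ : μ ≪ volume) (hμb : IsCompact μ.support)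
    (hνb : IsCompact ν.support) : ∃ u : E n → ℝ, IsOptimalPotential μ ν u := by
  have : CompactSpace ν.support := isCompact_iff_compactSpace.1 hνb
  have : Nonempty ν.support :=
    (Measure.nonempty_support (IsProbabilityMeasure.ne_zero ν)).to_subtype
  have hms : MeasurableSet ν.support := hνb.measurableSet
  -- Posing the dual problem on `spt ν` itself forces the gradients of the transform to lie there.
  let ν' : Measure ν.support := ν.comap (↑)
  have hrestr : ν.restrict ν.support = ν :=
    Measure.restrict_eq_self_of_ae_mem (s := ν.support) Measure.support_mem_ae
  have : IsProbabilityMeasure ν' := ⟨by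
    rw [comap_subtype_coe_apply hms, image_univ, Subtype.range_coe, ← Measure.restrict_apply_univ,
      hrestr, measure_univ]⟩
  obtain ⟨ψ, hψ⟩ := exists_dual_minimizer (μ := μ) (ν := ν') hμb
  obtain ⟨C, hC⟩ := exists_lipschitzWith_of_subdiff isBounded_of_compactSpace
    (subdiff_conj_inter_nonempty ψ)
  have hconv : ConvexOn ℝ univ (conj ψ) := convexOn_of_subdiff_nonempty fun x =>
    (subdiff_conj_inter_nonempty ψ x).mono inter_subset_left
  have hmeas := measurable_gradient (conj ψ)
  have hle : ∀ η : BoundedContinuousFunction (E n) ℝ,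
      ∫ x, η (gradient (conj ψ) x) ∂μ ≤ ∫ q, η q ∂ν := by
    intro η
    refine (integral_gradient_le_of_minimizer hμ hμb hψ η).trans_eq ?_
    rw [integral_subtype_comap hms (fun q => η q), hrestr]
  have hT : MeasurePreserving (gradient (conj ψ)) μ ν := by
    refine ⟨hmeas, ?_⟩
    have : IsProbabilityMeasure (μ.map (gradient (conj ψ))) :=
      Measure.isProbabilityMeasure_map hmeas.aemeasurable
    refine ext_of_forall_integral_eq_of_IsFiniteMeasure fun η => ?_
    rw [integral_map hmeas.aemeasurable η.continuous.aestronglyMeasurable]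
    refine le_antisymm (hle η) ?_
    have := hle (-η)
    simp only [BoundedContinuousFunction.coe_neg, Pi.neg_apply, integral_neg] at this
    linarith
  exact ⟨conj ψ, hconv, hC.ae_differentiableAt,
    isOptimalMap_gradient hμb hνb hconv (hμ.ae_le hC.ae_differentiableAt) hT,
    fun x hx => gradient_mem_of_subdiff (subdiff_conj_inter_nonempty ψ) hx⟩

end DCTears

theorem mainTheorem4 {n : ℕ} (μ ν : Measure (DCTears.E n))
    [IsProbabilityMeasure μ] [IsProbabilityMeasure ν]
    (hμ : μ ≪ volume) (hν : ν ≪ volume)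
    (hμb : Bornology.IsBounded μ.support) (hνb : Bornology.IsBounded ν.support)
    (Ω₁ Ω₂ : Set (DCTears.E n)) (hΩ₁ : Ω₁.Nonempty) (hΩ₂ : Ω₂.Nonempty)
    (hsplit : ν.support = Ω₁ ∪ Ω₂)
    (v : DCTears.E n) (a : ℝ) (hsep : DCTears.StronglySeparates v a Ω₂ Ω₁) :
    (∃ u : DCTears.E n → ℝ, DCTears.IsOptimalPotential μ ν u) ∧
    ∀ u : DCTears.E n → ℝ, DCTears.IsOptimalPotential μ ν u →
      (∃ u₁ u₂ : DCTears.E n → ℝ,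
        ConvexOn ℝ univ u₁ ∧ ConvexOn ℝ univ u₂ ∧
        (∀ x, u x = max (u₁ x) (u₂ x)) ∧
        (∀ x, DifferentiableAt ℝ u₁ x → gradient u₁ x ∈ Ω₁) ∧
        (∀ x, DifferentiableAt ℝ u₂ x → gradient u₂ x ∈ Ω₂) ∧
        DCTears.tear u Ω₁ Ω₂ = {x | u₁ x = u₂ x} ∧
        DCTears.missing u Ω₂ = {x | u₂ x < u₁ x} ∧
        DCTears.missing u Ω₁ = {x | u₁ x < u₂ x}) ∧
      IsConnected (DCTears.tear u Ω₁ Ω₂) ∧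
      IsConnected (DCTears.missing u Ω₂) ∧
      IsConnected (DCTears.missing u Ω₁) ∧
      (∃ h : DCTears.E n → ℝ,
        DCTears.IsDCOn (DCTears.hyperplane v a) h ∧
        (∃ K : ℝ≥0, LipschitzOnWith K h (DCTears.hyperplane v a)) ∧
        DCTears.tear u Ω₁ Ω₂ = DCTears.graphOver v (DCTears.hyperplane v a) h ∧
        DCTears.missing u Ω₂ = DCTears.openEpigraphOver v (DCTears.hyperplane v a) h ∧
        DCTears.missing u Ω₁ = DCTears.openSubgraphOver v (DCTears.hyperplane v a) h) ∧
      (Convex ℝ μ.support → IsConnected Ω₁ →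
        IsConnected (μ.support ∩ (DCTears.missing u Ω₂ ∪ DCTears.tear u Ω₁ Ω₂))) ∧
      (Convex ℝ μ.support → IsConnected Ω₂ →
        IsConnected (μ.support ∩ (DCTears.missing u Ω₁ ∪ DCTears.tear u Ω₁ Ω₂))) := by
  have hμc : IsCompact μ.support :=
    Metric.isCompact_of_isClosed_isBounded Measure.isClosed_support hμb
  have hνc : IsCompact ν.support :=
    Metric.isCompact_of_isClosed_isBounded Measure.isClosed_support hνb
  refine ⟨DCTears.exists_isOptimalPotential hμ hμc hνc, fun u hu => ?_⟩
  obtain ⟨hc₂, hc₁⟩ := hsep.isCompact hΩ₂ hΩ₁ (by rwa [union_comm, ← hsplit])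
  obtain ⟨w₁, w₂, hmax, hs₁, hs₂, ht₁, ht₂⟩ :=
    hu.exists_split hμ hμc hΩ₁ hΩ₂ hc₁ hc₂ hsplit
  obtain ⟨L₁, hL₁⟩ := DCTears.exists_lipschitzWith_of_subdiff hc₁.isBounded hs₁
  obtain ⟨L₂, hL₂⟩ := DCTears.exists_lipschitzWith_of_subdiff hc₂.isBounded hs₂
  obtain ⟨hv, d, hd, hsep⟩ := hsep
  have hle₁ : ∀ x, w₁ x ≤ u x := fun x => hmax x ▸ le_max_left _ _
  have hle₂ : ∀ x, w₂ x ≤ u x := fun x => hmax x ▸ le_max_right _ _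
  have hsl₁ : ∀ x, ∃ p ∈ DCTears.subdiff w₁ x, a + d ≤ inner ℝ p v := fun x => by
    obtain ⟨p, hp, hpΩ⟩ := hs₁ x
    obtain ⟨q, hq⟩ := hΩ₂
    exact ⟨p, hp, (hsep q hq p hpΩ).2.le⟩
  have hsl₂ : ∀ x, ∃ p ∈ DCTears.subdiff w₂ x, inner ℝ p v ≤ a - d := fun x => by
    obtain ⟨p, hp, hpΩ⟩ := hs₂ x
    obtain ⟨q, hq⟩ := hΩ₁
    exact ⟨p, hp, (hsep p hpΩ q hq).1.le⟩
  have heq₁ : ∀ x, w₁ x = u x ↔ w₂ x ≤ w₁ x := fun x => by rw [hmax x, left_eq_sup]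
  have heq₂ : ∀ x, w₂ x = u x ↔ w₁ x ≤ w₂ x := fun x => by rw [hmax x, right_eq_sup]
  have htear : DCTears.tear u Ω₁ Ω₂ = {x | w₁ x = w₂ x} := by
    ext x
    change (_ ∧ _) ↔ w₁ x = w₂ x
    rw [← ht₁, ← ht₂, heq₁, heq₂, and_comm, le_antisymm_iff]
  have hmiss₂ : DCTears.missing u Ω₂ = {x | w₂ x < w₁ x} := by
    ext x
    change _ = ∅ ↔ w₂ x < w₁ x
    rw [← not_nonempty_iff_eq_empty, ← ht₂, heq₂, not_le]
  have hmiss₁ : DCTears.missing u Ω₁ = {x | w₁ x < w₂ x} := by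
    ext x
    change _ = ∅ ↔ w₁ x < w₂ x
    rw [← not_nonempty_iff_eq_empty, ← ht₁, heq₁, not_le]
  obtain ⟨h, hh⟩ := DCTears.exists_height hd hL₁.continuous hL₂.continuous hsl₁ hsl₂
  have hh₀ : ∀ p, w₁ (p + h p • v) = w₂ (p + h p • v) := fun p => (hh p (h p)).1.2 rfl
  obtain ⟨L, hL⟩ := DCTears.exists_lipschitzWith_height hd hL₁ hL₂ hsl₁ hsl₂ hh₀
  have hgraph : DCTears.tear u Ω₁ Ω₂ = DCTears.graphOver v (DCTears.hyperplane v a) h := by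
    rw [htear]
    ext x
    constructor
    · intro hx
      obtain ⟨p, hp, t, rfl⟩ := DCTears.exists_eq_add_smul hv a x
      obtain rfl := (hh p t).1.1 hx
      exact ⟨p, hp, rfl⟩
    · rintro ⟨p, hp, rfl⟩
      exact hh₀ p
  have hepi : DCTears.missing u Ω₂ =
      DCTears.openEpigraphOver v (DCTears.hyperplane v a) h := by
    rw [hmiss₂]
    ext x
    constructor
    · intro hx
      obtain ⟨p, hp, t, rfl⟩ := DCTears.exists_eq_add_smul hv a x
      exact ⟨p, hp, t, (hh p t).2.1.1 hx, rfl⟩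
    · rintro ⟨p, hp, t, ht, rfl⟩
      exact (hh p t).2.1.2 ht
  have hsub : DCTears.missing u Ω₁ =
      DCTears.openSubgraphOver v (DCTears.hyperplane v a) h := by
    rw [hmiss₁]
    ext x
    constructor
    · intro hx
      obtain ⟨p, hp, t, rfl⟩ := DCTears.exists_eq_add_smul hv a x
      exact ⟨p, hp, t, (hh p t).2.2.1 hx, rfl⟩
    · rintro ⟨p, hp, t, ht, rfl⟩
      exact (hh p t).2.2.2 ht
  have hconn : IsConnected (DCTears.hyperplane v a) :=
    (DCTears.convex_hyperplane v a).isConnected (DCTears.nonempty_hyperplane hv a)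
  -- The tilts with `s = a - d` and `s = a` differ by `d * h p`, whence the factor `d⁻¹`.
  have hdc : DCTears.IsDCOn (DCTears.hyperplane v a) h := by
    have hconvex : ∀ s ∈ Icc (a - d) (a + d),
        ConvexOn ℝ (DCTears.hyperplane v a) fun p => d⁻¹ * (u (p + h p • v) - s * h p) :=
      fun s hs => ((DCTears.convexOn_tilted_height hu.convexOn hle₁ hle₂ hsl₁ hsl₂
        (fun p => (heq₁ _).2 (hh₀ p).ge) (fun p => (heq₂ _).2 (hh₀ p).le) hs).subset
        (subset_univ _) (DCTears.convex_hyperplane v a)).smul (inv_nonneg.2 hd.le)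
    refine ⟨_, _, hconvex (a - d) ⟨le_rfl, by linarith⟩,
      hconvex a ⟨by linarith, by linarith⟩, fun p _ => ?_⟩
    field_simp
    ring
  have hunion₁ : DCTears.missing u Ω₂ ∪ DCTears.tear u Ω₁ Ω₂ =
      {x | (DCTears.subdiff u x ∩ Ω₁).Nonempty} := by
    rw [htear, hmiss₂]
    ext x
    change (w₂ x < w₁ x ∨ w₁ x = w₂ x) ↔ (DCTears.subdiff u x ∩ Ω₁).Nonempty
    rw [← ht₁, heq₁, le_iff_lt_or_eq, eq_comm]
  have hunion₂ : DCTears.missing u Ω₁ ∪ DCTears.tear u Ω₁ Ω₂ =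
      {x | (DCTears.subdiff u x ∩ Ω₂).Nonempty} := by
    rw [htear, hmiss₁]
    ext x
    change (w₁ x < w₂ x ∨ w₁ x = w₂ x) ↔ (DCTears.subdiff u x ∩ Ω₂).Nonempty
    rw [← ht₂, heq₂, le_iff_lt_or_eq]
  refine ⟨⟨w₁, w₂, ?_, ?_, hmax, fun x hx => DCTears.gradient_mem_of_subdiff hs₁ hx,
    fun x hx => DCTears.gradient_mem_of_subdiff hs₂ hx, htear, hmiss₂, hmiss₁⟩, ?_, ?_, ?_,
    ⟨h, hdc, ⟨L, hL.lipschitzOnWith⟩, hgraph, hepi, hsub⟩, fun hconv hΩ => ?_, fun hconv hΩ => ?_⟩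
  · exact DCTears.convexOn_of_subdiff_nonempty fun x => (hs₁ x).mono inter_subset_left
  · exact DCTears.convexOn_of_subdiff_nonempty fun x => (hs₂ x).mono inter_subset_left
  · exact hgraph ▸ DCTears.isConnected_graphOver hconn hL.continuous
  · exact hepi ▸ DCTears.isConnected_openEpigraphOver hconn hL.continuous
  · exact hsub ▸ DCTears.isConnected_openSubgraphOver hconn hL.continuous
  · rw [hunion₁]
    exact hu.isConnected_support_inter hμ hμc hconv hΩ (hsplit ▸ subset_union_left)
  · rw [hunion₂]
    exact hu.isConnected_support_inter hμ hμc hconv hΩ (hsplit ▸ subset_union_right)
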